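/- Let $W$ be a simply-laced Coxeter group with finite set of Coxeter generators $S$, $|S|=n$, that is, $W$ is presented by the generators $S$ and the relations $(ss')^{m(s,s')}=1$, where $m(s,s)=1$ and $m(s,s')=m(s',s)\in\{2,3\}$ for $s\neq s'$. Its Coxeter graph has vertex set $S$ and an edge $ss'$ whenever $m(s,s')=3$. For $s\in S$ let $\mathbf{s}$ be the matrix over the two-element field $F_2$, with rows and columns indexed by $S$, whose entry $\mathbf{s}_{uv}$ is $1$ if $u=v$, or if $v=s$ and $uv$ is an edge, and is $0$ otherwise. These matrices are invertible and satisfy the defining relations of $W$; the Vogan representation of $W$ is the resulting homomorphism $\varphi:W\to \mathrm{GL}_n(F_2)$ with $\varphi(s)=\mathbf{s}$ for all $s\in S$. **Proposition.** If $W$ is of type $E_6$ (its Coxeter graph is the Dynkin diagram $E_6$), then $\varphi$ is faithful (that is, injective). If $W$ is of type $E_7$, then $|\mathrm{Ker}\,\varphi|=2$. In both cases $\mathrm{Ker}\,\varphi=Z(W)$, the center of $W$. -/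

import Mathlib

namespace FlippingPuzzle

/-- A Coxeter matrix is simply-laced if `m(s, s') ∈ {2, 3}` for all `s ≠ s'`. -/
def IsSimplyLaced {B : Type*} (M : CoxeterMatrix B) : Prop :=
  ∀ s t : B, s ≠ t → M s t = 2 ∨ M s t = 3

/-- The matrix over `F₂`, with rows and columns indexed by the vertices of the Coxeter graph, of the
move selecting the vertex `s`: the entry at `(u, v)` is `1` if `u = v`, or if `v = s` and `uv` is an
edge of the Coxeter graph (that is `m(u, v) = 3`), and `0` otherwise. -/
def moveMatrix {B : Type*} [DecidableEq B] (M : CoxeterMatrix B) (s : B) : Matrix B B (ZMod 2) :=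
  Matrix.of fun u v => if u = v ∨ (v = s ∧ M u v = 3) then 1 else 0

/-- The characteristic vector of the set of neighbours of `s`. -/
def nbr {B : Type*} (M : CoxeterMatrix B) (s : B) : B → ZMod 2 :=
  fun u => if M u s = 3 then 1 else 0

theorem moveMatrix_eq {B : Type*} [DecidableEq B] (M : CoxeterMatrix B) (s : B) :
    moveMatrix M s = 1 + Matrix.vecMulVec (nbr M s) (Pi.single s 1) := by
  ext u v
  simp only [moveMatrix, nbr, Matrix.of_apply, Matrix.add_apply, Matrix.one_apply,
    Matrix.vecMulVec_apply, Pi.single_apply]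
  by_cases huv : u = v
  · subst huv
    by_cases hus : u = s
    · simp [hus]
    · simp [hus]
  · by_cases hvs : v = s
    · subst hvs
      simp [huv]
    · simp [huv, hvs]

theorem vecMulVec_mul {B : Type*} [Fintype B] [DecidableEq B] (M : CoxeterMatrix B) (s t r : B) :
    Matrix.vecMulVec (nbr M s) (Pi.single t 1) * Matrix.vecMulVec (nbr M r) (Pi.single r 1) =
      (if M t r = 3 then (1 : ZMod 2) else 0) •
        Matrix.vecMulVec (nbr M s) (Pi.single r (1 : ZMod 2)) := by
  ext u v
  simp only [Matrix.mul_apply, Matrix.vecMulVec_apply, Matrix.smul_apply, smul_eq_mul,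
    Pi.single_apply, nbr]
  rw [Finset.sum_eq_single t]
  · simp only [if_true]; ring
  · intro b _ hb; simp [hb]
  · simp

theorem add_self_matrix {B : Type*} (A : Matrix B B (ZMod 2)) : A + A = 0 := by
  ext u v
  exact CharTwo.add_self_eq_zero (A u v)

/-- Every move is an involution. -/
theorem moveMatrix_mul_self {B : Type*} [Fintype B] [DecidableEq B] (M : CoxeterMatrix B) (s : B) :
    moveMatrix M s * moveMatrix M s = 1 := by
  have h := vecMulVec_mul M s s s
  have h2 := add_self_matrix (Matrix.vecMulVec (nbr M s) (Pi.single s (1 : ZMod 2)))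
  simp only [M.diagonal, OfNat.one_ne_ofNat, if_false, zero_smul] at h
  rw [moveMatrix_eq, mul_add, mul_one, add_mul, one_mul, h, add_zero, add_assoc, h2, add_zero]

/-- The move of the vertex `s`, as an element of `GL_n(F₂)`. -/
def move {B : Type*} [Fintype B] [DecidableEq B] (M : CoxeterMatrix B) (s : B) :
    Matrix.GeneralLinearGroup B (ZMod 2) where
  val := moveMatrix M s
  inv := moveMatrix M s
  val_inv := moveMatrix_mul_self M s
  inv_val := moveMatrix_mul_self M s

/-- The moves satisfy the defining relations of the Coxeter group. -/
theorem isLiftable_move {B : Type*} [Fintype B] [DecidableEq B] {M : CoxeterMatrix B}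
    (hM : IsSimplyLaced M) : M.IsLiftable (move M) := by
  intro s t
  have hsq : ∀ r, move M r * move M r = 1 := fun r => Units.ext (moveMatrix_mul_self M r)
  by_cases hst : s = t
  · subst hst
    rw [M.diagonal, pow_one, hsq]
  rcases hM s t hst with h | h
  · have hcomm : move M s * move M t = move M t * move M s := by
      apply Units.ext
      change moveMatrix M s * moveMatrix M t = moveMatrix M t * moveMatrix M s
      have h' : M t s = 2 := by rw [M.symmetric]; exact h
      have h1 := vecMulVec_mul M s s t
      have h2 := vecMulVec_mul M t t s
      rw [h] at h1
      rw [h'] at h2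
      norm_num at h1 h2
      rw [moveMatrix_eq, moveMatrix_eq]
      simp only [mul_add, add_mul, h1, h2, one_mul, mul_one, add_zero]
      abel
    rw [h, pow_two]
    calc move M s * move M t * (move M s * move M t)
        = move M s * move M t * (move M t * move M s) := by rw [← hcomm]
      _ = move M s * (move M t * move M t) * move M s := by simp only [mul_assoc]
      _ = 1 := by rw [hsq, mul_one, hsq]
  · have hbraid : move M s * move M t * move M s = move M t * move M s * move M t := by
      apply Units.ext
      change moveMatrix M s * moveMatrix M t * moveMatrix M s =
        moveMatrix M t * moveMatrix M s * moveMatrix M t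
      have h' : M t s = 3 := by rw [M.symmetric]; exact h
      have ha := vecMulVec_mul M s s s
      have hb := vecMulVec_mul M t t t
      have hab := vecMulVec_mul M s s t
      have hba := vecMulVec_mul M t t s
      have haba := vecMulVec_mul M s t s
      have hbab := vecMulVec_mul M t s t
      simp only [M.diagonal, h, h', OfNat.one_ne_ofNat, if_false, if_true, zero_smul,
        one_smul] at ha hb hab hba haba hbab
      rw [← hab] at haba
      rw [← hba] at hbab
      have h2a := add_self_matrix (Matrix.vecMulVec (nbr M s) (Pi.single s (1 : ZMod 2)))
      have h2b := add_self_matrix (Matrix.vecMulVec (nbr M t) (Pi.single t (1 : ZMod 2)))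
      rw [moveMatrix_eq, moveMatrix_eq]
      generalize Matrix.vecMulVec (nbr M s) (Pi.single s (1 : ZMod 2)) = a at *
      generalize Matrix.vecMulVec (nbr M t) (Pi.single t (1 : ZMod 2)) = b at *
      have e1 : (1 + a) * (1 + b) * (1 + a) =
          1 + (a + a) + b + a * b + b * a + a * a + a * b * a := by noncomm_ring
      have e2 : (1 + b) * (1 + a) * (1 + b) =
          1 + (b + b) + a + a * b + b * a + b * b + b * a * b := by noncomm_ring
      rw [e1, e2, ha, hb, haba, hbab, h2a, h2b]
      abel
    rw [h]
    calc (move M s * move M t) ^ 3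
        = (move M s * move M t * move M s) * (move M t * move M s * move M t) := by
          simp only [pow_succ, pow_zero, one_mul, mul_assoc]
      _ = (move M s * move M t * move M s) * (move M s * move M t * move M s) := by rw [hbraid]
      _ = move M s * (move M t * (move M s * move M s) * move M t) * move M s := by
          simp only [mul_assoc]
      _ = 1 := by rw [hsq, mul_one, hsq, mul_one, hsq]

/-- The Vogan representation of a simply-laced Coxeter group `W`: the homomorphism to `GL_n(F₂)`
that sends each Coxeter generator `s` to its move. -/
noncomputable def voganRep {B : Type*} [Fintype B] [DecidableEq B] {M : CoxeterMatrix B}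
    (hM : IsSimplyLaced M) {W : Type*} [Group W] (cs : CoxeterSystem M W) :
    W →* Matrix.GeneralLinearGroup B (ZMod 2) :=
  cs.lift ⟨move M, isLiftable_move hM⟩

end FlippingPuzzle

/-! Lift `φ` to characteristic zero: it is the reduction modulo 2 (`voganRep_eq_map`) of the
integral action `geomRep` on the weight lattice, where row `s` of the matrix of `w` is the root `w⁻¹
αₛ`. Positivity of these rows (`geomRep_row_nonneg`) makes `geomRep` faithful.

If `w` is in the kernel, each row is a root congruent to `αₛ` modulo 2. In an even positive definite
lattice this forces it to be `±αₛ` (`row_eq_of_map_eq_one`), and the invariant form on a connected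
graph makes all the signs agree. So the kernel consists of the `w` acting as `±1`, and
`mem_center_iff` describes the center in the same way.

It remains to see whether `-1` occurs. For `E₆` it does not: `W` fixes a nonzero functional modulo 3
that vanishes on the root lattice. For `E₇` it is the ninth power of a Coxeter element. -/

open Matrix

namespace FlippingPuzzle

/-! ### The integral reflection representation -/

section GeometricRepresentation

variable {B : Type*} [DecidableEq B]

/-- The Cartan matrix of a simply-laced Coxeter matrix. -/
def cartan (M : CoxeterMatrix B) : Matrix B B ℤ :=
  Matrix.of fun s t => if s = t then 2 else if M s t = 3 then -1 else 0

theorem cartan_self (M : CoxeterMatrix B) (s : B) : cartan M s s = 2 := by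
  simp [cartan]

theorem cartan_comm (M : CoxeterMatrix B) (s t : B) : cartan M s t = cartan M t s := by
  simp [cartan, M.symmetric s t, eq_comm]

theorem cartan_transpose (M : CoxeterMatrix B) : (cartan M)ᵀ = cartan M := by
  ext s t
  exact cartan_comm M t s

theorem cartan_of_eq_two {M : CoxeterMatrix B} {s t : B} (h : M s t = 2) : cartan M s t = 0 := by
  have hst : s ≠ t := by
    rintro rfl
    simp at h
  simp [cartan, hst, h]

theorem cartan_of_eq_three {M : CoxeterMatrix B} {s t : B} (h : M s t = 3) :
    cartan M s t = -1 := by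
  have hst : s ≠ t := by
    rintro rfl
    simp at h
  simp [cartan, hst, h]

variable [Fintype B]

/-- The action of a simple reflection on the weight lattice. -/
def reflMatrix (M : CoxeterMatrix B) (s : B) : Matrix B B ℤ :=
  1 - cartan M * Matrix.single s s 1

/-- The Coxeter relations reduce to this one product rule for rank-one matrices. -/
theorem cartan_mul_single_mul (M : CoxeterMatrix B) (s t r : B) :
    cartan M * Matrix.single s t 1 * (cartan M * Matrix.single r r 1) =
      cartan M t r • (cartan M * Matrix.single s r 1) := by
  rw [← Matrix.mul_smul, mul_assoc, ← mul_assoc (Matrix.single s t 1), Matrix.smul_single]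
  congr 1
  ext i j
  by_cases hi : i = s <;> by_cases hj : j = r <;>
    simp [Matrix.mul_apply, Matrix.single_apply, Ne.symm, hi, hj]

theorem reflMatrix_mul_apply (M : CoxeterMatrix B) (s : B) (A : Matrix B B ℤ) (r : B) :
    (reflMatrix M s * A) r = A r - cartan M r s • A s := by
  rw [reflMatrix, sub_mul, one_mul, mul_assoc]
  ext v
  simp [Matrix.mul_apply, Matrix.single_apply, ite_and]

theorem reflMatrix_mul_self (M : CoxeterMatrix B) (s : B) :
    reflMatrix M s * reflMatrix M s = 1 := by
  have h := cartan_mul_single_mul M s s s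
  rw [cartan_self] at h
  simp only [reflMatrix, mul_sub, sub_mul, mul_one, one_mul, h]
  rw [two_smul]
  abel

theorem isLiftable_reflMatrix {M : CoxeterMatrix B} (hM : IsSimplyLaced M) :
    M.IsLiftable (reflMatrix M) := by
  intro s t
  have hsq := reflMatrix_mul_self M
  by_cases hst : s = t
  · subst hst
    rw [M.diagonal, pow_one, hsq]
  rcases hM s t hst with h | h
  · have h' : M t s = 2 := by rw [M.symmetric, h]
    have hcomm : reflMatrix M s * reflMatrix M t = reflMatrix M t * reflMatrix M s := by
      have h1 := cartan_mul_single_mul M s s t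
      have h2 := cartan_mul_single_mul M t t s
      rw [cartan_of_eq_two h, zero_smul] at h1
      rw [cartan_of_eq_two h', zero_smul] at h2
      simp only [reflMatrix, mul_sub, sub_mul, mul_one, one_mul, h1, h2]
      abel
    rw [h, pow_two]
    calc reflMatrix M s * reflMatrix M t * (reflMatrix M s * reflMatrix M t)
        = reflMatrix M s * reflMatrix M t * (reflMatrix M t * reflMatrix M s) := by rw [← hcomm]
      _ = reflMatrix M s * (reflMatrix M t * reflMatrix M t) * reflMatrix M s := by
          simp only [mul_assoc]
      _ = 1 := by rw [hsq, mul_one, hsq]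
  · have h' : M t s = 3 := by rw [M.symmetric, h]
    have hbraid : reflMatrix M s * reflMatrix M t * reflMatrix M s =
        reflMatrix M t * reflMatrix M s * reflMatrix M t := by
      have ha := cartan_mul_single_mul M s s s
      have hb := cartan_mul_single_mul M t t t
      have hab := cartan_mul_single_mul M s s t
      have hba := cartan_mul_single_mul M t t s
      have haba := cartan_mul_single_mul M s t s
      have hbab := cartan_mul_single_mul M t s t
      rw [cartan_self, two_smul] at ha hb
      rw [cartan_of_eq_three h, neg_one_smul] at hab hbab
      rw [cartan_of_eq_three h', neg_one_smul] at hba haba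
      rw [← neg_eq_iff_eq_neg.mpr hab, neg_mul, neg_inj] at haba
      rw [← neg_eq_iff_eq_neg.mpr hba, neg_mul, neg_inj] at hbab
      simp only [reflMatrix]
      generalize cartan M * Matrix.single s s 1 = a at *
      generalize cartan M * Matrix.single t t 1 = b at *
      have e1 : (1 - a) * (1 - b) * (1 - a) =
          1 - (a + a) - b + a * b + b * a + a * a - a * b * a := by noncomm_ring
      have e2 : (1 - b) * (1 - a) * (1 - b) =
          1 - (b + b) - a + a * b + b * a + b * b - b * a * b := by noncomm_ring
      rw [e1, e2, ha, hb, haba, hbab]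
      abel
    rw [h]
    calc (reflMatrix M s * reflMatrix M t) ^ 3
        = (reflMatrix M s * reflMatrix M t * reflMatrix M s) *
            (reflMatrix M t * reflMatrix M s * reflMatrix M t) := by
          simp only [pow_succ, pow_zero, one_mul, mul_assoc]
      _ = (reflMatrix M s * reflMatrix M t * reflMatrix M s) *
            (reflMatrix M s * reflMatrix M t * reflMatrix M s) := by rw [hbraid]
      _ = reflMatrix M s * (reflMatrix M t * (reflMatrix M s * reflMatrix M s) *
            reflMatrix M t) * reflMatrix M s := by simp only [mul_assoc]
      _ = 1 := by rw [hsq, mul_one, hsq, mul_one, hsq]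

variable {M : CoxeterMatrix B} (hM : IsSimplyLaced M) {W : Type*} [Group W]
  (cs : CoxeterSystem M W)

/-- The integral reflection representation of `W` on the weight lattice. Its dual is the geometric
representation, so the row `s` of the matrix of `w` is the root `w⁻¹ αₛ` in terms of simple roots. -/
noncomputable def geomRep : W →* Matrix B B ℤ :=
  cs.lift ⟨reflMatrix M, isLiftable_reflMatrix hM⟩

theorem geomRep_simple (s : B) : geomRep hM cs (cs.simple s) = reflMatrix M s :=
  cs.lift_apply_simple (isLiftable_reflMatrix hM) s

theorem geomRep_simple_mul (s : B) (w : W) (r : B) :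
    geomRep hM cs (cs.simple s * w) r =
      geomRep hM cs w r - cartan M r s • geomRep hM cs w s := by
  rw [map_mul, geomRep_simple, reflMatrix_mul_apply]

theorem geomRep_simple_mul_self (s : B) (w : W) :
    geomRep hM cs (cs.simple s * w) s = -geomRep hM cs w s := by
  rw [geomRep_simple_mul, cartan_self, two_smul]
  abel

/-! ### Positive roots and faithfulness -/

/-- Strip a left descent `t` from `w`, and a further `s` if that is a descent of what remains. The
row becomes a row, or a sum of two rows, of a shorter element; the commutation or braid relation
excludes the unwanted descents. -/
theorem geomRep_row_nonneg (n : ℕ) : ∀ (w : W) (s : B), cs.length w = n →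
    ¬ cs.IsLeftDescent w s → 0 ≤ geomRep hM cs w s := by
  induction n using Nat.strong_induction_on with
  | _ n ih =>
  intro w s hn hs
  by_cases hw : w = 1
  · subst hw
    intro v
    rw [map_one, Matrix.one_apply]
    split_ifs <;> simp
  obtain ⟨t, ht⟩ := cs.exists_leftDescent_of_ne_one hw
  have hst : s ≠ t := by
    rintro rfl
    exact hs ht
  obtain ⟨v, rfl⟩ : ∃ v, w = cs.simple t * v := ⟨cs.simple t * w, by simp⟩
  have hlen := (cs.isLeftDescent_iff).1 ht
  have hs' := (cs.not_isLeftDescent_iff).1 hs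
  rw [cs.simple_mul_simple_cancel_left] at hlen
  have htv : ¬ cs.IsLeftDescent v t := by
    rw [cs.not_isLeftDescent_iff]
    exact hlen.symm
  rw [geomRep_simple_mul]
  rcases hM s t hst with h | h
  · rw [cartan_of_eq_two h, zero_smul, sub_zero]
    refine ih _ (by omega) v s rfl fun hd => ?_
    have hd' := (cs.isLeftDescent_iff).1 hd
    have hcomm : cs.simple s * (cs.simple t * v) = cs.simple t * (cs.simple s * v) := by
      have := cs.wordProd_braidWord_eq s t
      have h' : M t s = 2 := by rw [M.symmetric, h]
      simp only [CoxeterSystem.braidWord, h, h', CoxeterSystem.alternatingWord,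
        CoxeterSystem.wordProd_concat, CoxeterSystem.wordProd_nil, one_mul] at this
      rw [← mul_assoc, ← mul_assoc, this]
    have hle := cs.length_mul_le (cs.simple t) (cs.simple s * v)
    rw [← hcomm, cs.length_simple] at hle
    omega
  · rw [cartan_of_eq_three h, neg_one_smul, sub_neg_eq_add]
    by_cases hd : cs.IsLeftDescent v s
    · obtain ⟨u, rfl⟩ : ∃ u, v = cs.simple s * u := ⟨cs.simple s * v, by simp⟩
      have hd' := (cs.isLeftDescent_iff).1 hd
      rw [cs.simple_mul_simple_cancel_left] at hd'
      -- With `v = s u`, rows `s` and `t` of `v` are `-uₛ` and `uₜ + uₛ`, so their sum is row `t` of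
      -- `u`.
      rw [geomRep_simple_mul_self, geomRep_simple_mul hM cs s u t,
        cartan_of_eq_three (by rw [M.symmetric, h]), neg_one_smul, sub_neg_eq_add,
        neg_add_cancel_comm_assoc]
      refine ih _ (by omega) u t rfl fun hdu => ?_
      have hdu' := (cs.isLeftDescent_iff).1 hdu
      have hbraid : cs.simple s * (cs.simple t * (cs.simple s * u)) =
          cs.simple t * (cs.simple s * (cs.simple t * u)) := by
        have := cs.wordProd_braidWord_eq s t
        have h' : M t s = 3 := by rw [M.symmetric, h]
        simp only [CoxeterSystem.braidWord, h, h', CoxeterSystem.alternatingWord,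
          CoxeterSystem.wordProd_concat, CoxeterSystem.wordProd_nil, one_mul] at this
        simp only [← mul_assoc, this]
      have h1 := cs.length_mul_le (cs.simple t) (cs.simple s * (cs.simple t * u))
      have h2 := cs.length_mul_le (cs.simple s) (cs.simple t * u)
      rw [← hbraid, cs.length_simple] at h1
      rw [cs.length_simple] at h2
      omega
    · exact add_nonneg (ih _ (by omega) v s rfl hd) (ih _ (by omega) v t rfl htv)

/-- The geometric representation of a simply-laced Coxeter group is faithful. -/
theorem geomRep_injective {w : W} (h : geomRep hM cs w = 1) : w = 1 := by
  by_contra hw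
  obtain ⟨s, hs⟩ := cs.exists_leftDescent_of_ne_one hw
  obtain ⟨v, rfl⟩ : ∃ v, w = cs.simple s * v := ⟨cs.simple s * w, by simp⟩
  have hd := (cs.isLeftDescent_iff).1 hs
  rw [cs.simple_mul_simple_cancel_left] at hd
  -- Row `s` of `s v` is minus a nonnegative row, whereas the identity has `1` on the diagonal.
  have hpos := geomRep_row_nonneg hM cs _ v s rfl ((cs.not_isLeftDescent_iff).2 hd.symm) s
  have hneg := congrFun (geomRep_simple_mul_self hM cs s v) s
  rw [h] at hneg
  simp at hneg hpos
  omega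

theorem geomRep_inj {v w : W} (h : geomRep hM cs v = geomRep hM cs w) : v = w := by
  rw [← inv_mul_eq_one]
  apply geomRep_injective hM cs
  rw [map_mul, ← h, ← map_mul, inv_mul_cancel, map_one]

/-! ### The invariant form -/

theorem reflMatrix_mul_cartan_mul (s : B) :
    reflMatrix M s * cartan M * (reflMatrix M s)ᵀ = cartan M := by
  have h := cartan_mul_single_mul M s s s
  rw [cartan_self, two_smul] at h
  simp only [reflMatrix, transpose_sub, transpose_one, transpose_mul, cartan_transpose,
    Matrix.transpose_single, sub_mul, mul_sub, one_mul, mul_one]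
  have : cartan M * Matrix.single s s 1 * cartan M * (Matrix.single s s 1 * cartan M) =
      (cartan M * Matrix.single s s 1 * (cartan M * Matrix.single s s 1)) * cartan M := by
    simp only [mul_assoc]
  rw [this, h, add_mul, mul_assoc (cartan M) (Matrix.single s s 1)]
  abel

theorem geomRep_mul_cartan_mul (w : W) :
    geomRep hM cs w * cartan M * (geomRep hM cs w)ᵀ = cartan M := by
  induction w using cs.simple_induction_left with
  | one => simp
  | mul_simple_left w s ih =>
    rw [map_mul, geomRep_simple, transpose_mul]
    calc _ = reflMatrix M s * (geomRep hM cs w * cartan M * (geomRep hM cs w)ᵀ) *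
          (reflMatrix M s)ᵀ := by simp only [mul_assoc]
      _ = _ := by rw [ih, reflMatrix_mul_cartan_mul]

theorem row_dotProduct_cartan (w : W) (s t : B) :
    geomRep hM cs w s ⬝ᵥ cartan M *ᵥ geomRep hM cs w t = cartan M s t := by
  conv_rhs => rw [← geomRep_mul_cartan_mul hM cs w]
  rw [mul_assoc, Matrix.mul_apply]
  rfl

theorem dotProduct_cartan_comm (x y : B → ℤ) :
    x ⬝ᵥ cartan M *ᵥ y = y ⬝ᵥ cartan M *ᵥ x := by
  rw [dotProduct_comm, ← Matrix.vecMul_transpose, cartan_transpose, ← dotProduct_mulVec]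

/-- The root lattice is even. -/
theorem even_dotProduct_cartan (x : B → ℤ) : Even (x ⬝ᵥ cartan M *ᵥ x) := by
  rw [even_iff_two_dvd, ← Nat.cast_two, ← ZMod.intCast_zmod_eq_zero_iff_dvd]
  simp only [dotProduct, mulVec, Finset.mul_sum, Int.cast_sum]
  rw [← Fintype.sum_prod_type']
  -- Modulo 2 the terms at `(s, t)` and `(t, s)` cancel, and the diagonal terms `2 xₛ²` vanish.
  refine Finset.sum_involution (fun p _ => p.swap) ?_ ?_ (by simp) (by simp)
  · rintro ⟨s, t⟩ -
    have : x t * (cartan M t s * x s) = x s * (cartan M s t * x t) := by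
      rw [cartan_comm M t s]
      ring
    simp only [Prod.swap, this]
    exact CharTwo.add_self_eq_zero _
  · rintro ⟨s, t⟩ - h hst
    obtain rfl : t = s := congrArg Prod.fst hst
    apply h
    simp only [cartan_self, Int.cast_mul]
    rw [show ((2 : ℤ) : ZMod 2) = 0 from rfl]
    ring

/-! ### Reduction modulo 2, the kernel and the center -/

/-- The Vogan representation is the reduction modulo two of the action on the weight lattice. -/
theorem voganRep_eq_map (w : W) :
    (voganRep hM cs w).val = (geomRep hM cs w).map (Int.castRingHom (ZMod 2)) := by
  induction w using cs.simple_induction_left with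
  | one => simp
  | mul_simple_left w s ih =>
    rw [map_mul, map_mul, Units.val_mul, Matrix.map_mul, ih, geomRep_simple]
    congr 1
    have : voganRep hM cs (cs.simple s) = move M s := cs.lift_apply_simple (isLiftable_move hM) s
    rw [this]
    ext u v
    change moveMatrix M s u v = _
    simp only [moveMatrix, reflMatrix, cartan, Matrix.of_apply, Matrix.map_apply,
      Matrix.sub_apply, Matrix.one_apply, Matrix.mul_apply, Matrix.single_apply, mul_ite, mul_one,
      mul_zero, ite_and, Finset.sum_ite_eq, Finset.mem_univ, if_true]
    by_cases huv : u = v <;> by_cases hvs : s = v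
    · subst huv hvs
      simp
    · simp [huv, hvs]
    · subst hvs
      by_cases h3 : M u s = 3 <;> simp [huv, h3]
    · simp [huv, hvs, Ne.symm hvs, eq_comm]

theorem mem_ker_voganRep {w : W} :
    w ∈ (voganRep hM cs).ker ↔ (geomRep hM cs w).map (Int.castRingHom (ZMod 2)) = 1 := by
  rw [MonoidHom.mem_ker, ← voganRep_eq_map, Units.ext_iff, Units.val_one]

/-- The Cartan form is positive definite. -/
def IsPosDef (M : CoxeterMatrix B) : Prop :=
  ∀ x : B → ℤ, x ⬝ᵥ cartan M *ᵥ x ≤ 0 → x = 0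

/-- The Coxeter graph is connected. -/
def IsConnected (M : CoxeterMatrix B) : Prop :=
  ∀ ε : B → ℤ, (∀ s t, M s t = 3 → ε s = ε t) → ∀ s t, ε s = ε t

/-- Two roots that are congruent modulo two are equal up to sign. -/
theorem row_eq_of_map_eq_one (hpos : IsPosDef M) {w : W}
    (h : (geomRep hM cs w).map (Int.castRingHom (ZMod 2)) = 1) (s : B) :
    geomRep hM cs w s = Pi.single s 1 ∨ geomRep hM cs w s = -Pi.single s 1 := by
  have hdvd : ∀ v, ∃ c, geomRep hM cs w s v = (Pi.single s 1 : B → ℤ) v + 2 * c := by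
    intro v
    have hv := congrFun (congrFun h s) v
    have : (((geomRep hM cs w s v - (Pi.single s 1 : B → ℤ) v : ℤ)) : ZMod 2) = 0 := by
      rw [Int.cast_sub, sub_eq_zero]
      rw [Matrix.map_apply] at hv
      refine hv.trans ?_
      by_cases hs : s = v
      · subst hs; simp
      · simp [hs, Ne.symm hs]
    rw [ZMod.intCast_zmod_eq_zero_iff_dvd] at this
    obtain ⟨c, hc⟩ := this
    exact ⟨c, by push_cast at hc; linarith⟩
  choose c hc using hdvd
  have hrow : geomRep hM cs w s = Pi.single s 1 + (2 : ℤ) • c := by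
    ext v
    simpa using hc v
  have hs : (Pi.single s 1 : B → ℤ) ⬝ᵥ cartan M *ᵥ Pi.single s 1 = 2 := by
    simp [cartan_self]
  have hn := row_dotProduct_cartan hM cs w s s
  have hcomm := dotProduct_cartan_comm (M := M) c (Pi.single s 1)
  -- Since `αₛ + 2c` has norm 2, `(c, c) = -(αₛ, c)`, so `c + αₛ` has norm `2 - (c, c)`. As `(c, c)`
  -- is even, one of `c` and `c + αₛ` has norm at most 0 and hence is zero.
  have hadd : (c + Pi.single s 1) ⬝ᵥ cartan M *ᵥ (c + Pi.single s 1) =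
      c ⬝ᵥ cartan M *ᵥ c + 2 * ((Pi.single s 1 : B → ℤ) ⬝ᵥ cartan M *ᵥ c) + 2 := by
    rw [mulVec_add, dotProduct_add, add_dotProduct, add_dotProduct, hs, hcomm]
    ring
  rw [hrow, cartan_self, mulVec_add, dotProduct_add, add_dotProduct, add_dotProduct, mulVec_smul,
    smul_dotProduct, smul_dotProduct, dotProduct_smul, dotProduct_smul, hs, hcomm] at hn
  simp only [smul_eq_mul] at hn
  obtain ⟨k, hk⟩ := even_dotProduct_cartan (M := M) c
  rcases le_or_gt k 0 with hk0 | hk0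
  · left
    rw [hrow, hpos c (by omega)]
    simp
  · right
    have := eq_neg_of_add_eq_zero_left (hpos (c + Pi.single s 1) (by omega))
    rw [hrow, this, two_smul]
    abel

/-- Invariance of the form gives `c s * c t = 1` both for `s = t` and along edges, so `c` is a
constant sign. -/
theorem geomRep_eq_one_or_neg_one (hconn : IsConnected M) {w : W} (c : B → ℤ)
    (h : ∀ s, geomRep hM cs w s = c s • Pi.single s 1) :
    geomRep hM cs w = 1 ∨ geomRep hM cs w = -1 := by
  have hform : ∀ s t, c s * c t * cartan M s t = cartan M s t := by
    intro s t
    have := row_dotProduct_cartan hM cs w s t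
    rw [h, h, mulVec_smul, smul_dotProduct, dotProduct_smul] at this
    simpa [mul_assoc] using this
  have hsq : ∀ s, c s = 1 ∨ c s = -1 := by
    intro s
    have := hform s s
    rw [cartan_self] at this
    exact mul_self_eq_one_iff.1 (by omega)
  have hconst := hconn c fun s t hst => by
    have := hform s t
    rw [cartan_of_eq_three hst] at this
    rcases hsq s with h1 | h1 <;> rcases hsq t with h2 | h2 <;> simp [h1, h2] at this ⊢
  have hmat : ∀ a : ℤ, (∀ s, c s = a) → geomRep hM cs w = a • 1 := by
    intro a ha
    ext s t
    rw [h, ha, Matrix.smul_apply, Pi.smul_apply, Pi.single_apply, Matrix.one_apply]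
    simp [eq_comm]
  by_cases hB : ∃ s, c s = -1
  · obtain ⟨s, hs⟩ := hB
    right
    rw [hmat (-1) fun t => (hconst t s).trans hs, neg_one_smul]
  · left
    rw [hmat 1 fun t => (hsq t).resolve_right fun ht => hB ⟨t, ht⟩, one_smul]

theorem mem_ker_voganRep_iff (hpos : IsPosDef M) (hconn : IsConnected M) {w : W} :
    w ∈ (voganRep hM cs).ker ↔ geomRep hM cs w = 1 ∨ geomRep hM cs w = -1 := by
  rw [mem_ker_voganRep]
  constructor
  · intro h
    have hrow : ∀ s, ∃ c : ℤ, geomRep hM cs w s = c • Pi.single s 1 := fun s =>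
      (row_eq_of_map_eq_one hM cs hpos h s).elim (fun h => ⟨1, by simp [h]⟩)
        fun h => ⟨-1, by simp [h]⟩
    choose c hc using hrow
    exact geomRep_eq_one_or_neg_one hM cs hconn c hc
  · rintro (h | h)
    · simp [h]
    · rw [h]
      ext u v
      by_cases huv : u = v
      · subst huv
        simp
      · simp [huv]

theorem mem_center_iff (hconn : IsConnected M) {w : W} :
    w ∈ Subgroup.center W ↔ geomRep hM cs w = 1 ∨ geomRep hM cs w = -1 := by
  constructor
  · intro h
    refine geomRep_eq_one_or_neg_one hM cs hconn (fun s => geomRep hM cs w s s) fun s => ?_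
    have hcomm := congrArg (geomRep hM cs) (Subgroup.mem_center_iff.1 h (cs.simple s))
    rw [map_mul, map_mul, geomRep_simple, reflMatrix, sub_mul, mul_sub, one_mul, mul_one,
      sub_right_inj] at hcomm
    ext v
    -- For `v ≠ s` the `(s, v)` entry of the commutation relation says that twice the `(s, v)` entry
    -- of `w` is zero.
    have hv := congrFun (congrFun hcomm s) v
    rw [mul_assoc, ← mul_assoc (geomRep hM cs w)] at hv
    by_cases hsv : s = v
    · subst hsv
      simp
    · simp [Matrix.mul_apply, Matrix.single_apply, ite_and, cartan_self, hsv] at hv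
      simp [hv, Ne.symm hsv]
  · intro h
    rw [Subgroup.mem_center_iff]
    intro g
    apply geomRep_inj hM cs
    rw [map_mul, map_mul]
    rcases h with h | h <;> simp [h]

theorem ker_voganRep_eq_center (hpos : IsPosDef M) (hconn : IsConnected M) :
    (voganRep hM cs).ker = Subgroup.center W := by
  ext w
  rw [mem_ker_voganRep_iff hM cs hpos hconn, mem_center_iff hM cs hconn]

/-- The Weyl group acts trivially on the quotient of the weight lattice by the root lattice. -/
theorem vecMul_map_geomRep {R : Type*} [CommRing R] (f : B → R)
    (hf : f ᵥ* (cartan M).map (Int.castRingHom R) = 0) (w : W) :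
    f ᵥ* (geomRep hM cs w).map (Int.castRingHom R) = f := by
  induction w using cs.simple_induction_left with
  | one => simp
  | mul_simple_left w s ih =>
    rw [map_mul, Matrix.map_mul, ← vecMul_vecMul, geomRep_simple, reflMatrix,
      Matrix.map_sub _ (map_sub _), Matrix.map_mul, vecMul_sub, ← vecMul_vecMul, hf]
    simpa using ih

/-! ### Relabelling the generators -/

theorem voganRep_reindex {B' : Type*} [Fintype B'] [DecidableEq B'] (e : B ≃ B')
    (hM' : IsSimplyLaced (M.reindex e)) (w : W) :
    (voganRep hM' (cs.reindex e) w).val = Matrix.reindex e e (voganRep hM cs w).val := by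
  induction w using cs.simple_induction_left with
  | one => simp
  | mul_simple_left w s ih =>
    rw [map_mul, map_mul, Units.val_mul, Units.val_mul, ih, Matrix.reindex_apply,
      Matrix.reindex_apply, ← Matrix.submatrix_mul_equiv _ _ _ e.symm]
    congr 1
    have h1 : voganRep hM cs (cs.simple s) = move M s := cs.lift_apply_simple (isLiftable_move hM) s
    have h2 : voganRep hM' (cs.reindex e) (cs.simple s) = move (M.reindex e) (e s) := by
      have := (cs.reindex e).lift_apply_simple (isLiftable_move hM') (e s)
      rwa [CoxeterSystem.reindex_simple, e.symm_apply_apply] at this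
    rw [h1, h2]
    ext u v
    change moveMatrix (M.reindex e) (e s) u v = moveMatrix M s (e.symm u) (e.symm v)
    simp [moveMatrix, CoxeterMatrix.reindex_apply, e.symm_apply_eq]
    congr

theorem ker_voganRep_reindex {B' : Type*} [Fintype B'] [DecidableEq B'] (e : B ≃ B')
    (hM' : IsSimplyLaced (M.reindex e)) :
    (voganRep hM' (cs.reindex e)).ker = (voganRep hM cs).ker := by
  ext w
  rw [MonoidHom.mem_ker, MonoidHom.mem_ker, Units.ext_iff, Units.ext_iff, Units.val_one,
    Units.val_one, voganRep_reindex hM cs e hM']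
  rw [Matrix.reindex_apply]
  constructor
  · intro h
    have := congrArg (fun A => A.submatrix e e) h
    simpa using this
  · intro h
    simp [h]

theorem IsSimplyLaced.reindex {B B' : Type*} {M : CoxeterMatrix B} (hM : IsSimplyLaced M)
    (e : B ≃ B') : IsSimplyLaced (M.reindex e) :=
  fun s t hst => hM (e.symm s) (e.symm t) (e.symm.injective.ne hst)

end GeometricRepresentation

/-! ### Type `E₆` -/

section E₆

open CoxeterMatrix

theorem cartan_E₆ : cartan E₆ =
    !![2, 0, -1, 0, 0, 0; 0, 2, 0, -1, 0, 0; -1, 0, 2, -1, 0, 0; 0, -1, -1, 2, -1, 0;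
      0, 0, 0, -1, 2, -1; 0, 0, 0, 0, -1, 2] := by
  decide

theorem isPosDef_E₆ : IsPosDef E₆ := by
  intro x hx
  -- Complete squares along each of the three arms towards the branch node `3`, leaving `x 3 ^ 2`.
  have key : 6 * (x ⬝ᵥ cartan E₆ *ᵥ x) = 3 * (2 * x 0 - x 2) ^ 2 + (3 * x 2 - 2 * x 3) ^ 2 +
      3 * (2 * x 1 - x 3) ^ 2 + 3 * (2 * x 5 - x 4) ^ 2 + (3 * x 4 - 2 * x 3) ^ 2 + x 3 ^ 2 := by
    rw [cartan_E₆]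
    simp [dotProduct, mulVec, Fin.sum_univ_succ]
    ring
  have h0 := sq_nonneg (2 * x 0 - x 2)
  have h1 := sq_nonneg (2 * x 1 - x 3)
  have h2 := sq_nonneg (3 * x 2 - 2 * x 3)
  have h3 := sq_nonneg (x 3)
  have h4 := sq_nonneg (3 * x 4 - 2 * x 3)
  have h5 := sq_nonneg (2 * x 5 - x 4)
  have e0 := pow_eq_zero_iff two_ne_zero |>.1 (show (2 * x 0 - x 2) ^ 2 = 0 by linarith)
  have e1 := pow_eq_zero_iff two_ne_zero |>.1 (show (2 * x 1 - x 3) ^ 2 = 0 by linarith)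
  have e2 := pow_eq_zero_iff two_ne_zero |>.1 (show (3 * x 2 - 2 * x 3) ^ 2 = 0 by linarith)
  have e3 := pow_eq_zero_iff two_ne_zero |>.1 (show (x 3) ^ 2 = 0 by linarith)
  have e4 := pow_eq_zero_iff two_ne_zero |>.1 (show (3 * x 4 - 2 * x 3) ^ 2 = 0 by linarith)
  have e5 := pow_eq_zero_iff two_ne_zero |>.1 (show (2 * x 5 - x 4) ^ 2 = 0 by linarith)
  ext i
  fin_cases i <;> simp <;> omega

theorem isConnected_E₆ : IsConnected E₆ := by
  intro ε h
  have h02 := h 0 2 (by decide)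
  have h13 := h 1 3 (by decide)
  have h23 := h 2 3 (by decide)
  have h34 := h 3 4 (by decide)
  have h45 := h 4 5 (by decide)
  have hall : ∀ s, ε s = ε 3 := by
    intro s
    fin_cases s <;> simp <;> omega
  exact fun s t => (hall s).trans (hall t).symm

theorem geomRep_E₆_ne_neg_one (hM : IsSimplyLaced E₆) {W : Type*} [Group W]
    (cs : CoxeterSystem E₆ W) (w : W) : geomRep hM cs w ≠ -1 := by
  intro h
  -- This vector lies in the left kernel of the Cartan matrix modulo 3; `-1` would negate it instead
  -- of fixing it.
  have hf := vecMul_map_geomRep hM cs (R := ZMod 3) ![1, 0, 2, 0, 1, 2]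
    (by rw [cartan_E₆]; decide) w
  rw [h] at hf
  revert hf
  decide

theorem ker_voganRep_E₆ (hM : IsSimplyLaced E₆) {W : Type*} [Group W]
    (cs : CoxeterSystem E₆ W) : (voganRep hM cs).ker = ⊥ := by
  rw [eq_bot_iff]
  intro w hw
  rw [mem_ker_voganRep_iff hM cs isPosDef_E₆ isConnected_E₆] at hw
  exact geomRep_injective hM cs (hw.resolve_right (geomRep_E₆_ne_neg_one hM cs w))

end E₆

/-! ### Type `E₇` -/

section E₇

open CoxeterMatrix

theorem cartan_E₇ : cartan E₇ =
    !![2, 0, -1, 0, 0, 0, 0; 0, 2, 0, -1, 0, 0, 0; -1, 0, 2, -1, 0, 0, 0;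
      0, -1, -1, 2, -1, 0, 0; 0, 0, 0, -1, 2, -1, 0; 0, 0, 0, 0, -1, 2, -1;
      0, 0, 0, 0, 0, -1, 2] := by
  decide

theorem isPosDef_E₇ : IsPosDef E₇ := by
  intro x hx
  have key : 12 * (x ⬝ᵥ cartan E₇ *ᵥ x) = 6 * (2 * x 0 - x 2) ^ 2 +
      2 * (3 * x 2 - 2 * x 3) ^ 2 + 6 * (2 * x 1 - x 3) ^ 2 + 6 * (2 * x 6 - x 5) ^ 2 +
      2 * (3 * x 5 - 2 * x 4) ^ 2 + (4 * x 4 - 3 * x 3) ^ 2 + x 3 ^ 2 := by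
    rw [cartan_E₇]
    simp [dotProduct, mulVec, Fin.sum_univ_succ]
    ring
  have h0 := sq_nonneg (2 * x 0 - x 2)
  have h1 := sq_nonneg (2 * x 1 - x 3)
  have h2 := sq_nonneg (3 * x 2 - 2 * x 3)
  have h3 := sq_nonneg (x 3)
  have h4 := sq_nonneg (4 * x 4 - 3 * x 3)
  have h5 := sq_nonneg (3 * x 5 - 2 * x 4)
  have h6 := sq_nonneg (2 * x 6 - x 5)
  have e0 := pow_eq_zero_iff two_ne_zero |>.1 (show (2 * x 0 - x 2) ^ 2 = 0 by linarith)
  have e1 := pow_eq_zero_iff two_ne_zero |>.1 (show (2 * x 1 - x 3) ^ 2 = 0 by linarith)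
  have e2 := pow_eq_zero_iff two_ne_zero |>.1 (show (3 * x 2 - 2 * x 3) ^ 2 = 0 by linarith)
  have e3 := pow_eq_zero_iff two_ne_zero |>.1 (show (x 3) ^ 2 = 0 by linarith)
  have e4 := pow_eq_zero_iff two_ne_zero |>.1 (show (4 * x 4 - 3 * x 3) ^ 2 = 0 by linarith)
  have e5 := pow_eq_zero_iff two_ne_zero |>.1 (show (3 * x 5 - 2 * x 4) ^ 2 = 0 by linarith)
  have e6 := pow_eq_zero_iff two_ne_zero |>.1 (show (2 * x 6 - x 5) ^ 2 = 0 by linarith)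
  ext i
  fin_cases i <;> simp <;> omega

theorem isConnected_E₇ : IsConnected E₇ := by
  intro ε h
  have h02 := h 0 2 (by decide)
  have h13 := h 1 3 (by decide)
  have h23 := h 2 3 (by decide)
  have h34 := h 3 4 (by decide)
  have h45 := h 4 5 (by decide)
  have h56 := h 5 6 (by decide)
  have hall : ∀ s, ε s = ε 3 := by
    intro s
    fin_cases s <;> simp <;> omega
  exact fun s t => (hall s).trans (hall t).symm

/-- The action of a Coxeter element of `E₇`. -/
def coxeterMatrixE₇ : Matrix (Fin 7) (Fin 7) ℤ :=
    !![-1, 0, -1, -1, -1, -1, -1; 0, -1, 0, -1, -1, -1, -1; 1, 0, 0, 0, 0, 0, 0;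
      0, 1, 1, 1, 1, 1, 1; 0, 0, 0, 1, 0, 0, 0; 0, 0, 0, 0, 1, 0, 0;
      0, 0, 0, 0, 0, 1, 0]

theorem prod_reflMatrix_E₇ : ((List.finRange 7).map (reflMatrix E₇)).prod = coxeterMatrixE₇ := by
  have hf : List.finRange 7 = [0, 1, 2, 3, 4, 5, 6] := by decide
  -- Row operations replace matrix products, keeping the evaluation by `decide` small.
  have hmul : ∀ s (A : Matrix (Fin 7) (Fin 7) ℤ), reflMatrix E₇ s * A =
      Matrix.of fun r => A r - cartan E₇ r s • A s := by
    intro s A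
    funext r
    exact reflMatrix_mul_apply E₇ s A r
  rw [hf, cartan_E₇] at *
  simp only [List.map_cons, List.map_nil, List.prod_cons, List.prod_nil, hmul]
  decide

theorem coxeterMatrixE₇_pow_three : coxeterMatrixE₇ ^ 3 =
    !![0, 0, -1, -1, -1, 0, 0; -1, -1, -1, -2, -2, -1, -1; 0, -1, 0, -1, -1, -1, 0;
      0, 1, 0, 1, 1, 0, 0; 1, 0, 1, 1, 1, 1, 0; 0, 1, 1, 1, 1, 1, 1;
      0, 0, 0, 1, 0, 0, 0] := by
  rw [pow_three]
  decide

/-- The Coxeter number of `E₇` is `18`, and the ninth power of a Coxeter element acts as `-1`. -/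
theorem coxeterMatrixE₇_pow_nine : coxeterMatrixE₇ ^ 9 = -1 := by
  rw [pow_mul coxeterMatrixE₇ 3 3, coxeterMatrixE₇_pow_three, pow_three]
  decide

theorem exists_geomRep_E₇_eq_neg_one (hM : IsSimplyLaced E₇) {W : Type*} [Group W]
    (cs : CoxeterSystem E₇ W) : ∃ w, geomRep hM cs w = -1 := by
  refine ⟨cs.wordProd (List.finRange 7) ^ 9, ?_⟩
  rw [map_pow, ← coxeterMatrixE₇_pow_nine, ← prod_reflMatrix_E₇, CoxeterSystem.wordProd,
    map_list_prod, List.map_map]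
  congr 3
  ext1 s
  exact geomRep_simple hM cs s

theorem card_ker_voganRep_E₇ (hM : IsSimplyLaced E₇) {W : Type*} [Group W]
    (cs : CoxeterSystem E₇ W) : Nat.card (voganRep hM cs).ker = 2 := by
  obtain ⟨w₀, hw₀⟩ := exists_geomRep_E₇_eq_neg_one hM cs
  have hset : ((voganRep hM cs).ker : Set W) = {1, w₀} := by
    ext w
    rw [SetLike.mem_coe, mem_ker_voganRep_iff hM cs isPosDef_E₇ isConnected_E₇,
      Set.mem_insert_iff, Set.mem_singleton_iff]
    refine or_congr ⟨geomRep_injective hM cs, fun h => by rw [h, map_one]⟩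
      ⟨fun h => geomRep_inj hM cs (h.trans hw₀.symm), fun h => h ▸ hw₀⟩
  have hne : (1 : W) ≠ w₀ := by
    rintro rfl
    rw [map_one] at hw₀
    exact absurd (congrFun (congrFun hw₀ 0) 0) (by decide)
  have hcard := Set.ncard_pair hne
  rwa [← hset] at hcard

end E₇

end FlippingPuzzle

theorem proposition7p6 {B : Type*} [Fintype B] [DecidableEq B] {M : CoxeterMatrix B}
    (hM : FlippingPuzzle.IsSimplyLaced M) {W : Type*} [Group W] (cs : CoxeterSystem M W) :
    ((∃ e : B ≃ Fin 6, M.reindex e = CoxeterMatrix.E₆) →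
      Function.Injective (FlippingPuzzle.voganRep hM cs) ∧
      (FlippingPuzzle.voganRep hM cs).ker = Subgroup.center W) ∧
    ((∃ e : B ≃ Fin 7, M.reindex e = CoxeterMatrix.E₇) →
      Nat.card (FlippingPuzzle.voganRep hM cs).ker = 2 ∧
      (FlippingPuzzle.voganRep hM cs).ker = Subgroup.center W) := by
  -- The type of the Coxeter system depends on the matrix, so `M'` is kept as a variable that `rfl`
  -- can substitute.
  have of_reindex_E₆ : ∀ (M' : CoxeterMatrix (Fin 6)), M' = CoxeterMatrix.E₆ →
      ∀ (hM' : FlippingPuzzle.IsSimplyLaced M') (cs' : CoxeterSystem M' W),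
      (FlippingPuzzle.voganRep hM' cs').ker = ⊥ ∧
      (FlippingPuzzle.voganRep hM' cs').ker = Subgroup.center W := by
    rintro _ rfl hM' cs'
    exact ⟨FlippingPuzzle.ker_voganRep_E₆ hM' cs', FlippingPuzzle.ker_voganRep_eq_center hM' cs'
      FlippingPuzzle.isPosDef_E₆ FlippingPuzzle.isConnected_E₆⟩
  have of_reindex_E₇ : ∀ (M' : CoxeterMatrix (Fin 7)), M' = CoxeterMatrix.E₇ →
      ∀ (hM' : FlippingPuzzle.IsSimplyLaced M') (cs' : CoxeterSystem M' W),
      Nat.card (FlippingPuzzle.voganRep hM' cs').ker = 2 ∧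
      (FlippingPuzzle.voganRep hM' cs').ker = Subgroup.center W := by
    rintro _ rfl hM' cs'
    exact ⟨FlippingPuzzle.card_ker_voganRep_E₇ hM' cs',
      FlippingPuzzle.ker_voganRep_eq_center hM' cs'
        FlippingPuzzle.isPosDef_E₇ FlippingPuzzle.isConnected_E₇⟩
  constructor
  · rintro ⟨e, he⟩
    have h := of_reindex_E₆ _ he (hM.reindex e) (cs.reindex e)
    rw [FlippingPuzzle.ker_voganRep_reindex hM cs e] at h
    exact ⟨(MonoidHom.ker_eq_bot_iff _).1 h.1, h.2⟩
  · rintro ⟨e, he⟩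
    have h := of_reindex_E₇ _ he (hM.reindex e) (cs.reindex e)
    rwa [FlippingPuzzle.ker_voganRep_reindex hM cs e] at h
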